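/- For a finite matroid $M$ with rank function $r$ and subsets $X,Y$ of its ground set $E(M)$, write $\sqcap(X,Y)=r(X)+r(Y)-r(X\cup Y)$. An exact 3-separation of $M$ is a partition $(A,B)$ of $E(M)$ with $|A|,|B|\ge 3$ and $r(A)+r(B)-r(M)=2$. Given such $(A,B)$, an $A$-strand is an inclusion-minimal subset $A'$ of $A$ with $\sqcap(A',B)=1$, and a $B$-strand is an inclusion-minimal subset $B'$ of $B$ with $\sqcap(B',A)=1$. An extension of $M$ by an element $p\notin E(M)$ is a matroid $M'$ with ground set $E(M)\cup\{p\}$ and $M'\backslash p=M$. Theorem 1.1. Let $(A,B)$ be an exact 3-separation of a finite matroid $M$, let $A_0$ be an $A$-strand and $B_0$ a $B$-strand such that $\sqcap(A_0,B_0)=1$, and let $p\notin E(M)$. Then $M$ has an extension by $p$ in which $A_0\cup\{p\}$ and $B_0\cup\{p\}$ are both circuits if and only if there are no $A$-strand $A_1\ne A_0$ and $B$-strand $B_1\ne B_0$ such that exactly two of $\sqcap(A_0,B_1)$, $\sqcap(A_1,B_0)$, $\sqcap(A_1,B_1)$ are equal to one. Moreover, when $M$ has an extension by $p$ in which $A_0\cup\{p\}$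 and $B_0\cup\{p\}$ are both circuits, this extension is unique. -/

import Mathlib

namespace Matroid

variable {α : Type*}

/-- The rank of a set as an integer. For a finite matroid `M.eRk X` is never `⊤`. -/
noncomputable def rkInt (M : Matroid α) (X : Set α) : ℤ := ((M.eRk X).toNat : ℤ)

/-- The local connectivity `⊓(X, Y) = r(X) + r(Y) - r(X ∪ Y)`. -/
noncomputable def localConn (M : Matroid α) (X Y : Set α) : ℤ :=
  M.rkInt X + M.rkInt Y - M.rkInt (X ∪ Y)

/-- `(A, B)` is an exact 3-separation of `M`: a partition of the ground set into two sets with at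
least three elements each, such that `r(A) + r(B) - r(M) = 2`. -/
structure IsExactThreeSeparation (M : Matroid α) (A B : Set α) : Prop where
  union_eq : A ∪ B = M.E
  disjoint : Disjoint A B
  three_le_left : 3 ≤ A.encard
  three_le_right : 3 ≤ B.encard
  conn_eq : M.rkInt A + M.rkInt B - M.rkInt M.E = 2

/-- For an exact 3-separation with sides `A` and `B`, `S` is an `A`-strand: an inclusion-minimal
subset of `A` with `⊓(S, B) = 1`. A `B`-strand is `M.IsStrand B A S`. -/
def IsStrand (M : Matroid α) (A B S : Set α) : Prop :=
  Minimal (fun S' ↦ S' ⊆ A ∧ M.localConn S' B = 1) S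

/-- `N` is an extension of `M` by the element `p`: `p` is an element of `N` and deleting it
from `N` gives `M`. -/
def IsExtensionBy (N M : Matroid α) (p : α) : Prop :=
  p ∈ N.E ∧ N.delete {p} = M

end Matroid

/-- Exactly two of the three propositions hold. -/
def ExactlyTwo (P Q R : Prop) : Prop :=
  (P ∧ Q ∧ ¬ R) ∨ (P ∧ ¬ Q ∧ R) ∨ (¬ P ∧ Q ∧ R)

/-! Picture the guts of `(A, B)` as a line of rank 2 lying in the spans of both sides. A set `S ⊆ A`
with `⊓(S, B) = 1` picks out a point of this line, as does a set `T ⊆ B` with `⊓(A, T) = 1`, and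
`⊓(S, T)` is 1 or 0 according to whether the two points agree. These points need not be elements of
`M`, so agreement is only a numerical relation between the sides. The new element can be placed at
the point of `A₀` and `B₀` exactly when agreement with that pair is consistent, which is
`IsCompatiblePair`.

If `p` is such a point, then `S ∪ T` spans `p` iff `S` does, or `T` does, or `S` and `T` meet the
line without a common point and so together span it. This is `SpansGutsPoint`, and
`IsGutsPair.rkInt_insert_eq_iff_spansGutsPoint` proves it for every valid extension. As the
condition involves `M` alone, the extension is unique; compatibility follows by similar counting.
Conversely, compatibility makes the sets satisfying `SpansGutsPoint` a modular cut, checked one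
element at a time: upward closed, invariant under closure, and closed under intersection of modular
pairs. `exists_isExtensionBy_of_spanning_family` turns such a family into an extension. -/

namespace Matroid

/-! ### Integer rank and local connectivity. -/

section Rank

variable {α : Type*} {M : Matroid α} {X Y Z S S' T T' : Set α} {e f : α}

lemma rkInt_empty (M : Matroid α) : M.rkInt ∅ = 0 := by simp [rkInt]

lemma eRk_ne_top [M.Finite] (X : Set α) : M.eRk X ≠ ⊤ :=
  eRk_ne_top_iff.2 (M.isRkFinite_set X)

lemma rkInt_mono [M.Finite] (h : X ⊆ Y) : M.rkInt X ≤ M.rkInt Y := by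
  have := ENat.toNat_le_toNat (M.eRk_mono h) (eRk_ne_top Y)
  simpa [rkInt] using this

/-- Submodularity of the rank function, with any subset of the intersection. -/
lemma rkInt_union_add_le [M.Finite] (hX : Z ⊆ X) (hY : Z ⊆ Y) :
    M.rkInt (X ∪ Y) + M.rkInt Z ≤ M.rkInt X + M.rkInt Y := by
  have h := M.eRk_inter_add_eRk_union_le X Y
  have hZ := rkInt_mono (M := M) (Set.subset_inter hX hY)
  have h' := ENat.toNat_le_toNat h (by simp)
  rw [ENat.toNat_add (eRk_ne_top _) (eRk_ne_top _),
    ENat.toNat_add (eRk_ne_top _) (eRk_ne_top _)] at h'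
  simp only [rkInt] at *
  omega

lemma rkInt_insert_le [M.Finite] (e : α) (X : Set α) :
    M.rkInt (insert e X) ≤ M.rkInt X + 1 := by
  have h' := ENat.toNat_le_toNat (M.eRk_insert_le_add_one e X) (by simp)
  rw [ENat.toNat_add (eRk_ne_top _) (by simp)] at h'
  simp only [rkInt, ENat.toNat_one] at *
  omega

lemma rkInt_le_insert [M.Finite] (e : α) (X : Set α) : M.rkInt X ≤ M.rkInt (insert e X) :=
  rkInt_mono (Set.subset_insert e X)

lemma rkInt_insert_eq_of_subset [M.Finite] (hXY : X ⊆ Y) (h : M.rkInt (insert e X) = M.rkInt X) :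
    M.rkInt (insert e Y) = M.rkInt Y := by
  have h1 := rkInt_union_add_le (M := M) (Set.subset_insert e X) hXY
  rw [Set.insert_union, Set.union_eq_self_of_subset_left hXY] at h1
  have := rkInt_le_insert (M := M) e Y
  omega

lemma rkInt_insert_insert_add_le [M.Finite] (e f : α) (X : Set α) :
    M.rkInt (insert e (insert f X)) + M.rkInt X ≤
      M.rkInt (insert e X) + M.rkInt (insert f X) := by
  have h := rkInt_union_add_le (M := M) (Set.subset_insert e X) (Set.subset_insert f X)
  rwa [Set.insert_union, Set.union_eq_self_of_subset_left (Set.subset_insert f X)] at h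

lemma indep_iff_rkInt [M.Finite] {I : Set α} :
    M.Indep I ↔ I ⊆ M.E ∧ M.rkInt I = (I.ncard : ℤ) := by
  by_cases hI : I ⊆ M.E
  · have hfin : I.encard ≠ ⊤ := by simpa using M.set_finite I hI
    rw [indep_iff_eRk_eq_encard, and_iff_right hI, rkInt, Set.ncard, Nat.cast_inj,
      ← ENat.natCast_inj, ENat.natCast_toNat (eRk_ne_top _), ENat.natCast_toNat hfin]
  · exact iff_of_false (fun h ↦ hI h.subset_ground) (fun h ↦ hI h.1)

lemma localConn_comm (M : Matroid α) (X Y : Set α) : M.localConn X Y = M.localConn Y X := by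
  rw [localConn, localConn, Set.union_comm]
  ring

lemma localConn_empty_left (M : Matroid α) (X : Set α) : M.localConn ∅ X = 0 := by
  simp [localConn, rkInt_empty]

lemma localConn_empty_right (M : Matroid α) (X : Set α) : M.localConn X ∅ = 0 := by
  simp [localConn, rkInt_empty]

lemma localConn_nonneg [M.Finite] (X Y : Set α) : 0 ≤ M.localConn X Y := by
  have := rkInt_union_add_le (M := M) (Set.empty_subset X) (Set.empty_subset Y)
  rw [rkInt_empty] at this
  rw [localConn]
  omega

lemma localConn_mono_left [M.Finite] (h : S ⊆ S') (T : Set α) :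
    M.localConn S T ≤ M.localConn S' T := by
  have := rkInt_union_add_le (M := M) h (Set.subset_union_left (s := S) (t := T))
  rw [← Set.union_assoc, Set.union_eq_self_of_subset_right h] at this
  rw [localConn, localConn]
  omega

lemma localConn_mono_right [M.Finite] (S : Set α) (h : T ⊆ T') :
    M.localConn S T ≤ M.localConn S T' := by
  rw [localConn_comm, M.localConn_comm S]
  exact localConn_mono_left h S

/-- Local connectivity has increasing differences. -/
lemma localConn_sub_le_sub [M.Finite] (hS : S ⊆ S') (hT : T ⊆ T') :
    M.localConn S' T + M.localConn S T' ≤ M.localConn S' T' + M.localConn S T := by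
  have := rkInt_union_add_le (M := M) (Set.union_subset_union_left T hS)
    (Set.union_subset_union_right S hT)
  rw [Set.union_union_union_comm, Set.union_eq_self_of_subset_right hS,
    Set.union_eq_self_of_subset_left hT] at this
  simp only [localConn]
  omega

/-- In a finite matroid each bracketed difference is 0 or 1, and 0 means that `e` is spanned.
Closure arguments thereby become integer arithmetic. -/
lemma localConn_insert_left (M : Matroid α) (e : α) (S T : Set α) :
    M.localConn (insert e S) T =
      M.localConn S T + (M.rkInt (insert e S) - M.rkInt S)
        - (M.rkInt (insert e (S ∪ T)) - M.rkInt (S ∪ T)) := by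
  simp only [localConn, Set.insert_union]
  ring

lemma localConn_insert_right (M : Matroid α) (e : α) (S T : Set α) :
    M.localConn S (insert e T) =
      M.localConn S T + (M.rkInt (insert e T) - M.rkInt T)
        - (M.rkInt (insert e (S ∪ T)) - M.rkInt (S ∪ T)) := by
  simp only [localConn, Set.union_insert]
  ring

end Rank

/-! ### Matroids from rank functions, and single-element extensions. -/

section OfRank

variable {α : Type*} {E : Set α}

/-- A function on the subsets of a finite set that has unit increase and is locally submodular
is the rank function of a matroid. -/
theorem exists_matroid_indep_iff_of_unit_increase (hE : E.Finite) (r : Set α → ℤ)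
    (r_empty : r ∅ = 0)
    (r_le : ∀ X ⊆ E, ∀ e ∈ E, r X ≤ r (insert e X))
    (r_insert_le : ∀ X ⊆ E, ∀ e ∈ E, r (insert e X) ≤ r X + 1)
    (r_local : ∀ X ⊆ E, ∀ e ∈ E, ∀ f ∈ E, r (insert e X) = r X → r (insert f X) = r X →
      r (insert e (insert f X)) = r X) :
    ∃ N : Matroid α, N.E = E ∧ ∀ I, N.Indep I ↔ I ⊆ E ∧ r I = (I.ncard : ℤ) := by
  have key : ∀ X ⊆ E, ∀ Y ⊆ E, Disjoint X Y → r X ≤ r (X ∪ Y) ∧ r (X ∪ Y) ≤ r X + Y.ncard := by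
    intro X hX Y hY hdj
    induction Y, hE.subset hY using Set.Finite.induction_on with
    | empty => simp
    | @insert a Y haY hYfin ih =>
      rw [Set.insert_subset_iff] at hY
      have ih := ih hY.2 (hdj.mono_right (Set.subset_insert a Y))
      have h1 := r_le (X ∪ Y) (Set.union_subset hX hY.2) a hY.1
      have h2 := r_insert_le (X ∪ Y) (Set.union_subset hX hY.2) a hY.1
      rw [Set.union_insert, Set.ncard_insert_of_notMem haY hYfin]
      push_cast
      omega
  have r_le_ncard : ∀ X ⊆ E, r X ≤ X.ncard := by
    intro X hX
    have := (key ∅ (Set.empty_subset E) X hX (Set.empty_disjoint X)).2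
    rw [Set.empty_union] at this
    omega
  have r_mono : ∀ Y ⊆ E, ∀ X ⊆ Y, r X ≤ r Y ∧ r Y ≤ r X + (Y \ X).ncard := by
    intro Y hY X hXY
    have := key X (hXY.trans hY) (Y \ X) (Set.sdiff_subset.trans hY) Set.disjoint_sdiff_right
    rwa [Set.union_sdiff_cancel hXY] at this
  refine ⟨(IndepMatroid.ofFinite hE (fun I ↦ I ⊆ E ∧ r I = (I.ncard : ℤ))
    ⟨Set.empty_subset E, by simpa using r_empty⟩ ?_ ?_ (fun I h ↦ h.1)).matroid, rfl,
    fun I ↦ Iff.rfl⟩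
  · rintro I J ⟨hJ, hrJ⟩ hIJ
    refine ⟨hIJ.trans hJ, le_antisymm (r_le_ncard I (hIJ.trans hJ)) ?_⟩
    have h1 := (r_mono J hJ I hIJ).2
    have h2 := Set.ncard_sdiff_add_ncard_of_subset hIJ (hE.subset hJ)
    omega
  · rintro I J ⟨hI, hrI⟩ ⟨hJ, hrJ⟩ hlt
    by_contra! hcon
    have hno : ∀ e ∈ J, r (insert e I) = r I := by
      intro e he
      by_cases heI : e ∈ I
      · rw [Set.insert_eq_of_mem heI]
      have h1 := hcon e he heI (Set.insert_subset (hJ he) hI)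
      rw [Set.ncard_insert_of_notMem heI (hE.subset hI)] at h1
      have h2 := r_le I hI e (hJ he)
      have h3 := r_insert_le I hI e (hJ he)
      push_cast at h1
      omega
    -- If no element of `J` augments `I`, adding all of `J` leaves the rank at `r I`, which is less
    -- than `r J`.
    have hspan : ∀ K ⊆ J, r (I ∪ K) = r I ∧ ∀ e ∈ J, r (insert e (I ∪ K)) = r I := by
      intro K hK
      induction K, (hE.subset hJ).subset hK using Set.Finite.induction_on with
      | empty => simpa using hno
      | @insert a K haK hKfin ih =>
        rw [Set.insert_subset_iff] at hK
        obtain ⟨h1, h2⟩ := ih hK.2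
        rw [Set.union_insert]
        refine ⟨h2 a hK.1, fun e he ↦ ?_⟩
        rw [r_local (I ∪ K) (Set.union_subset hI (hK.2.trans hJ)) e (hJ he) a (hJ hK.1)
          ((h2 e he).trans h1.symm) ((h2 a hK.1).trans h1.symm), h1]
    have h1 := (hspan J subset_rfl).1
    have h2 := (r_mono (I ∪ J) (Set.union_subset hI hJ) J Set.subset_union_right).1
    omega

/-- A single-element extension of a finite matroid is given by a family `G` of subsets of the
ground set, those that are to span the new element. -/
theorem exists_isExtensionBy_of_spanning_family (M : Matroid α) [M.Finite] {p : α} (hp : p ∉ M.E)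
    (G : Set α → Prop)
    (G_insert : ∀ X ⊆ M.E, ∀ e ∈ M.E, G X → G (insert e X))
    (G_of_insert : ∀ X ⊆ M.E, ∀ e ∈ M.E, M.rkInt (insert e X) = M.rkInt X → G (insert e X) → G X)
    (G_of_insert_insert : ∀ X ⊆ M.E, ∀ e ∈ M.E, ∀ f ∈ M.E,
      M.rkInt (insert e (insert f X)) = M.rkInt X + 2 → G (insert e X) → G (insert f X) → G X) :
    ∃ N : Matroid α, N.IsExtensionBy M p ∧
      ∀ I ⊆ M.E, N.Indep (insert p I) ↔ M.Indep I ∧ ¬ G I := by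
  classical
  -- The intended rank function of the extension: `p` raises the rank of a set exactly when that set
  -- is outside `G`.
  set r : Set α → ℤ := fun X ↦
    M.rkInt (X \ {p}) + if p ∈ X ∧ ¬ G (X \ {p}) then 1 else 0 with hr
  have hr0 : ∀ X, p ∉ X → r X = M.rkInt X := by
    intro X hX
    simp [hr, hX]
  have hr1 : ∀ X, p ∉ X → r (insert p X) = M.rkInt X + if G X then 0 else 1 := by
    intro X hX
    by_cases hG : G X <;> simp [hr, hX, hG]
  have notMem : ∀ X ⊆ M.E, p ∉ X := fun X hX h ↦ hp (hX h)
  have hdiff : ∀ X ⊆ insert p M.E, p ∈ X → ∃ Y ⊆ M.E, X = insert p Y := fun X hX hpX ↦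
    ⟨X \ {p}, Set.sdiff_singleton_subset_iff.2 hX,
      by rw [Set.insert_sdiff_singleton, Set.insert_eq_of_mem hpX]⟩
  have hdiff' : ∀ X ⊆ insert p M.E, p ∉ X → X ⊆ M.E := fun X hX hpX ↦
    (Set.subset_insert_iff_of_notMem hpX).1 hX
  have hstep : ∀ X ⊆ insert p M.E, ∀ e ∈ insert p M.E,
      r X ≤ r (insert e X) ∧ r (insert e X) ≤ r X + 1 := by
    intro X hX e he
    by_cases hpX : p ∈ X
    · obtain ⟨Y, hY, rfl⟩ := hdiff X hX hpX
      obtain rfl | he := he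
      · rw [Set.insert_idem]
        omega
      rw [Set.insert_comm, hr1 _ (notMem _ (Set.insert_subset he hY)), hr1 _ (notMem _ hY)]
      have h1 := rkInt_le_insert (M := M) e Y
      have h2 := rkInt_insert_le (M := M) e Y
      have h3 := G_insert Y hY e he
      have h4 := G_of_insert Y hY e he
      split_ifs <;> grind
    · have hY := hdiff' X hX hpX
      obtain rfl | he := he
      · rw [hr1 _ hpX, hr0 _ hpX]
        split_ifs <;> omega
      rw [hr0 _ hpX, hr0 _ (notMem _ (Set.insert_subset he hY))]
      exact ⟨rkInt_le_insert e X, rkInt_insert_le e X⟩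
  have hp_local : ∀ X ⊆ M.E, ∀ e ∈ M.E, r (insert p X) = r X → r (insert e X) = r X →
      r (insert p (insert e X)) = r X := by
    intro X hX e he
    rw [hr1 _ (notMem _ hX), hr1 _ (notMem _ (Set.insert_subset he hX)), hr0 _ (notMem _ hX),
      hr0 _ (notMem _ (Set.insert_subset he hX))]
    have h3 := G_insert X hX e he
    split_ifs <;> grind
  obtain ⟨N, hNE, hN⟩ := exists_matroid_indep_iff_of_unit_increase (M.ground_finite.insert p) r
    (by rw [hr0 _ (Set.notMem_empty p), rkInt_empty]) (fun X hX e he ↦ (hstep X hX e he).1)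
    (fun X hX e he ↦ (hstep X hX e he).2) (by
      intro X hX e he f hf h1 h2
      by_cases hpX : p ∈ X
      · obtain ⟨Y, hY, rfl⟩ := hdiff X hX hpX
        obtain rfl | he := he
        · rw [Set.insert_comm, Set.insert_idem, h2]
        obtain rfl | hf := hf
        · rw [Set.insert_idem, h1]
        rw [Set.insert_comm, hr1 _ (notMem _ (Set.insert_subset he hY)), hr1 _ (notMem _ hY)] at h1
        rw [Set.insert_comm, hr1 _ (notMem _ (Set.insert_subset hf hY)), hr1 _ (notMem _ hY)] at h2
        rw [Set.insert_comm f, Set.insert_comm e,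
          hr1 _ (notMem _ (Set.insert_subset he (Set.insert_subset hf hY))), hr1 _ (notMem _ hY)]
        have a1 := G_insert Y hY e he
        have a2 := G_insert Y hY f hf
        have a3 := G_of_insert Y hY e he
        have a4 := G_of_insert Y hY f hf
        have a5 := G_insert (insert f Y) (Set.insert_subset hf hY) e he
        have a6 := G_of_insert (insert f Y) (Set.insert_subset hf hY) e he
        -- The critical case: `Y` is not in `G`, both one-element enlargements are, and `e`, `f`
        -- together raise the rank by 2. Local submodularity would fail there.
        have a7 := G_of_insert_insert Y hY e he f hf
        have a8 := rkInt_insert_insert_add_le (M := M) e f Y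
        have a9 := rkInt_le_insert (M := M) e (insert f Y)
        have b1 := rkInt_le_insert (M := M) f Y
        have b2 := G_insert (insert e Y) (Set.insert_subset he hY) f hf
        have b3 := rkInt_le_insert (M := M) f (insert e Y)
        rw [Set.insert_comm f e] at b2 b3
        split_ifs at h1 h2 ⊢ <;> grind
      · have hY := hdiff' X hX hpX
        obtain rfl | he := he
        · obtain rfl | hf := hf
          · rw [Set.insert_idem, h1]
          exact hp_local X hY f hf h1 h2
        obtain rfl | hf := hf
        · rw [Set.insert_comm]
          exact hp_local X hY e he h2 h1
        rw [hr0 _ hpX, hr0 _ (notMem _ (Set.insert_subset he hY))] at h1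
        rw [hr0 _ hpX, hr0 _ (notMem _ (Set.insert_subset hf hY))] at h2
        rw [hr0 _ hpX, hr0 _ (notMem _ (Set.insert_subset he (Set.insert_subset hf hY)))]
        have a8 := rkInt_insert_insert_add_le (M := M) e f X
        have a9 := rkInt_le_insert (M := M) e (insert f X)
        omega)
  refine ⟨N, ⟨by simp [hNE], ext_indep (by simp [hNE, hp]) ?_⟩, ?_⟩
  · intro I hI
    have hIE : I ⊆ M.E := by simpa [hNE, hp] using hI
    rw [delete_indep_iff, hN, indep_iff_rkInt, hr0 _ (notMem _ hIE), Set.disjoint_singleton_right,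
      and_iff_left (notMem _ hIE), and_iff_right hIE,
      and_iff_right (hIE.trans (Set.subset_insert p M.E))]
  · intro I hI
    rw [hN, indep_iff_rkInt, hr1 _ (notMem _ hI), and_iff_right (Set.insert_subset_insert hI),
      and_iff_right hI, Set.ncard_insert_of_notMem (notMem _ hI) (M.set_finite I hI)]
    have hle : M.rkInt I ≤ I.ncard := by
      have := ENat.toNat_le_toNat (M.eRk_le_encard I) (by simpa using M.set_finite I hI)
      simpa [rkInt, Set.ncard] using this
    by_cases hG : G I <;> simp [hG]
    omega

end OfRank

/-! ### The family of sets that should span the new point. -/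

section Guts

variable {α : Type*}

/-- The numerical data attached to strands `A₀` and `B₀` of an exact 3-separation `(A, B)`
that determine a point common to both sides. -/
structure IsGutsPair (M : Matroid α) (A B A₀ B₀ : Set α) : Prop where
  left_subset : A₀ ⊆ A
  right_subset : B₀ ⊆ B
  conn_sides : M.localConn A B = 2
  conn_left : M.localConn A₀ B = 1
  conn_right : M.localConn A B₀ = 1
  conn_pair : M.localConn A₀ B₀ = 1

/-- There are no sets `S` and `T` of local connectivity one to the other side such that exactly
three of the four pairs formed by one of `A₀`, `S` and one of `B₀`, `T` have local
connectivity one. -/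
def IsCompatiblePair (M : Matroid α) (A B A₀ B₀ : Set α) : Prop :=
  ∀ S ⊆ A, ∀ T ⊆ B, M.localConn S B = 1 → M.localConn A T = 1 →
    ¬ ExactlyTwo (M.localConn A₀ T = 1) (M.localConn S B₀ = 1) (M.localConn S T = 1)

/-- The set `S ∪ T`, with `S` in `A` and `T` in `B`, is to span the point determined by
`A₀` and `B₀`. -/
def SpansGutsPoint (M : Matroid α) (A B A₀ B₀ S T : Set α) : Prop :=
  M.localConn S B₀ = 1 ∨ M.localConn A₀ T = 1 ∨
    (1 ≤ M.localConn S B ∧ 1 ≤ M.localConn A T ∧ M.localConn S T = 0)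

variable {M : Matroid α} {A B A₀ B₀ S S' T : Set α} {e f : α}

lemma IsGutsPair.symm (h : M.IsGutsPair A B A₀ B₀) : M.IsGutsPair B A B₀ A₀ where
  left_subset := h.right_subset
  right_subset := h.left_subset
  conn_sides := M.localConn_comm A B ▸ h.conn_sides
  conn_left := M.localConn_comm A B₀ ▸ h.conn_right
  conn_right := M.localConn_comm A₀ B ▸ h.conn_left
  conn_pair := M.localConn_comm A₀ B₀ ▸ h.conn_pair

lemma IsCompatiblePair.symm (h : M.IsCompatiblePair A B A₀ B₀) :
    M.IsCompatiblePair B A B₀ A₀ := by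
  intro T hT S hS h1 h2
  have := h S hS T hT (M.localConn_comm B S ▸ h2) (M.localConn_comm T A ▸ h1)
  rw [M.localConn_comm B₀ S, M.localConn_comm T A₀, M.localConn_comm T S]
  unfold ExactlyTwo at *
  tauto

lemma spansGutsPoint_comm (M : Matroid α) (A B A₀ B₀ S T : Set α) :
    M.SpansGutsPoint A B A₀ B₀ S T ↔ M.SpansGutsPoint B A B₀ A₀ T S := by
  unfold SpansGutsPoint
  rw [M.localConn_comm B₀ S, M.localConn_comm T A₀, M.localConn_comm T S,
    M.localConn_comm T A, M.localConn_comm B S]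
  tauto

section Finite

variable [M.Finite]

/-- Passing from `B` to `B₀` costs `A` exactly one unit of connectivity; by increasing differences
it costs a subset of `A` no more. -/
lemma IsGutsPair.localConn_right_le (h : M.IsGutsPair A B A₀ B₀) (hS : S ⊆ A) :
    0 ≤ M.localConn S B₀ ∧ M.localConn S B₀ ≤ 1 ∧ M.localConn S B₀ ≤ M.localConn S B ∧
      M.localConn S B ≤ M.localConn S B₀ + 1 ∧ M.localConn S B ≤ 2 :=  by
  have h1 := localConn_nonneg (M := M) S B₀
  have h2 := localConn_mono_left (M := M) hS B₀
  have h3 := localConn_mono_right (M := M) S h.right_subset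
  have h4 := localConn_sub_le_sub (M := M) hS h.right_subset
  have h5 := localConn_mono_left (M := M) hS B
  have := h.conn_right
  have := h.conn_sides
  omega

lemma IsGutsPair.localConn_left_le (h : M.IsGutsPair A B A₀ B₀) (hT : T ⊆ B) :
    0 ≤ M.localConn A₀ T ∧ M.localConn A₀ T ≤ 1 ∧ M.localConn A₀ T ≤ M.localConn A T ∧
      M.localConn A T ≤ M.localConn A₀ T + 1 ∧ M.localConn A T ≤ 2 := by
  rw [M.localConn_comm A₀ T, M.localConn_comm A T]
  exact h.symm.localConn_right_le hT

/-- The last inequality is the dimension bound for two subspaces of a rank-2 line. -/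
lemma IsGutsPair.localConn_le (h : M.IsGutsPair A B A₀ B₀) (hS : S ⊆ A) (hT : T ⊆ B) :
    0 ≤ M.localConn S T ∧ M.localConn S T ≤ M.localConn S B ∧ M.localConn S T ≤ M.localConn A T ∧
      M.localConn S B + M.localConn A T ≤ 2 + M.localConn S T := by
  have h1 := localConn_nonneg (M := M) S T
  have h2 := localConn_mono_left (M := M) hS T
  have h3 := localConn_mono_right (M := M) S hT
  have h4 := localConn_sub_le_sub (M := M) hS hT
  have := h.conn_sides
  omega

lemma SpansGutsPoint.mono_left (hG : M.SpansGutsPoint A B A₀ B₀ S T) (h : M.IsGutsPair A B A₀ B₀)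
    (hSS' : S ⊆ S') (hS' : S' ⊆ A) (hT : T ⊆ B) : M.SpansGutsPoint A B A₀ B₀ S' T := by
  have h1 := h.localConn_right_le (hSS'.trans hS')
  have h2 := h.localConn_right_le hS'
  have h3 := h.localConn_left_le hT
  have h4 := h.localConn_le (hSS'.trans hS') hT
  have h5 := h.localConn_le hS' hT
  have h6 := localConn_mono_left (M := M) hSS' B₀
  have h7 := localConn_mono_left (M := M) hSS' B
  have h8 := localConn_sub_le_sub (M := M) hSS' hT
  unfold SpansGutsPoint at *
  omega

/-- Since `e` is spanned by `S ∪ T`, and hence by `S ∪ B`, adding it to `S` raises `⊓(S, T)` and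
`⊓(S, B)` equally. The delicate case is when `S` misses the guts and `S ∪ {e}` meets them at the
point of `B₀`: it then agrees with `T` too, and compatibility makes `T` agree with `A₀`. -/
lemma SpansGutsPoint.of_insert_left (hG : M.SpansGutsPoint A B A₀ B₀ (insert e S) T)
    (h : M.IsGutsPair A B A₀ B₀) (hc : M.IsCompatiblePair A B A₀ B₀)
    (he : e ∈ A) (hS : S ⊆ A) (hT : T ⊆ B)
    (hr : M.rkInt (insert e (S ∪ T)) = M.rkInt (S ∪ T)) : M.SpansGutsPoint A B A₀ B₀ S T := by
  have hS' := Set.insert_subset he hS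
  have h1 := h.localConn_right_le hS
  have h2 := h.localConn_right_le hS'
  have h3 := h.localConn_left_le hT
  have h4 := h.localConn_le hS hT
  have h5 := h.localConn_le hS' hT
  have h6 := M.localConn_insert_left e S T
  have h7 := M.localConn_insert_left e S B
  have h8 := M.localConn_insert_left e S B₀
  have h9 := rkInt_insert_eq_of_subset (Set.union_subset_union_right S hT) hr
  have b1 := rkInt_le_insert (M := M) e S
  have b2 := rkInt_insert_le (M := M) e S
  have b3 := rkInt_insert_le (M := M) e (S ∪ B₀)
  have b4 := rkInt_le_insert (M := M) e (S ∪ B₀)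
  have hc := hc _ hS' T hT
  unfold SpansGutsPoint ExactlyTwo at *
  omega

/-- As `e` and `f` are independent over `S ∪ T`, adding them leaves `⊓(S, T)` unchanged. If each
made `S` newly span the point, both would be spanned by `S ∪ B₀`, giving `⊓(S ∪ {e, f}, B₀) = 2`. If
each merely brought `S` to meet the guts, `S ∪ {e, f}` would contain the whole line and so meet `T`.
Compatibility plays no role. -/
lemma SpansGutsPoint.of_insert_insert_left
    (he' : M.SpansGutsPoint A B A₀ B₀ (insert e S) T)
    (hf' : M.SpansGutsPoint A B A₀ B₀ (insert f S) T)
    (h : M.IsGutsPair A B A₀ B₀)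
    (he : e ∈ A) (hf : f ∈ A) (hS : S ⊆ A) (hT : T ⊆ B)
    (hr : M.rkInt (insert e (insert f (S ∪ T))) = M.rkInt (S ∪ T) + 2) :
    M.SpansGutsPoint A B A₀ B₀ S T := by
  have hSe := Set.insert_subset he hS
  have hSf := Set.insert_subset hf hS
  have hSef := Set.insert_subset he hSf
  have h0 := h.localConn_right_le hS
  have h1 := h.localConn_right_le hSe
  have h2 := h.localConn_right_le hSf
  have h3 := h.localConn_right_le hSef
  have h4 := h.localConn_left_le hT
  have h5 := h.localConn_le hS hT
  have h8 := h.localConn_le hSef hT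
  have a1 := M.localConn_insert_left e S T
  have a2 := M.localConn_insert_left f S T
  have a3 := M.localConn_insert_left e (insert f S) T
  have a4 := M.localConn_insert_left e S B
  have a5 := M.localConn_insert_left f S B
  have a6 := M.localConn_insert_left e (insert f S) B
  have a7 := M.localConn_insert_left e S B₀
  have a8 := M.localConn_insert_left f S B₀
  have a9 := M.localConn_insert_left e (insert f S) B₀
  rw [Set.insert_union] at a3 a6 a9
  have c1 := rkInt_insert_insert_add_le (M := M) e f (S ∪ T)
  have c2 := rkInt_insert_insert_add_le (M := M) e f (S ∪ B)
  have c3 := rkInt_insert_insert_add_le (M := M) e f (S ∪ B₀)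
  have c4 := rkInt_insert_insert_add_le (M := M) e f S
  have c5 := rkInt_insert_le (M := M) e (S ∪ T)
  have c6 := rkInt_insert_le (M := M) f (S ∪ T)
  have c7 := rkInt_insert_le (M := M) e S
  have c8 := rkInt_insert_le (M := M) f S
  have c9 := rkInt_le_insert (M := M) e (S ∪ B)
  have d1 := rkInt_le_insert (M := M) f (S ∪ B)
  have d2 := rkInt_le_insert (M := M) e (S ∪ B₀)
  have d3 := rkInt_le_insert (M := M) f (S ∪ B₀)
  have e1 := localConn_mono_left (M := M) (Set.subset_insert e S) T
  have e2 := localConn_mono_left (M := M) (Set.subset_insert f S) T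
  have e3 := localConn_mono_left (M := M) (Set.subset_insert e (insert f S)) T
  have e4 := localConn_sub_le_sub (M := M) (Set.subset_insert e S) h.right_subset
  have e5 := localConn_sub_le_sub (M := M) (Set.subset_insert f S) h.right_subset
  unfold SpansGutsPoint at *
  omega

/-- Again all connectivities between `S`, `S ∪ {e}` and `T`, `T ∪ {f}` coincide. If `S ∪ {e}` agrees
with `B₀` and `T ∪ {f}` with `A₀`, compatibility makes them agree with each other when each meets
the guts in one point, so `⊓(S, T)` is already nonzero. -/
lemma SpansGutsPoint.of_insert_left_of_insert_right
    (he' : M.SpansGutsPoint A B A₀ B₀ (insert e S) T)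
    (hf' : M.SpansGutsPoint A B A₀ B₀ S (insert f T))
    (h : M.IsGutsPair A B A₀ B₀) (hc : M.IsCompatiblePair A B A₀ B₀)
    (he : e ∈ A) (hf : f ∈ B) (hS : S ⊆ A) (hT : T ⊆ B)
    (hr : M.rkInt (insert e (insert f (S ∪ T))) = M.rkInt (S ∪ T) + 2) :
    M.SpansGutsPoint A B A₀ B₀ S T := by
  have hSe := Set.insert_subset he hS
  have hTf := Set.insert_subset hf hT
  have h0 := h.localConn_right_le hS
  have h1 := h.localConn_right_le hSe
  have h2 := h.localConn_left_le hT
  have h3 := h.localConn_left_le hTf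
  have h4 := h.localConn_le hS hT
  have h5 := h.localConn_le hSe hTf
  have a1 := M.localConn_insert_left e S T
  have a2 := M.localConn_insert_right f S T
  have a3 := M.localConn_insert_right f (insert e S) T
  rw [Set.insert_union, Set.insert_comm] at a3
  have c1 := rkInt_insert_insert_add_le (M := M) e f (S ∪ T)
  have c5 := rkInt_insert_le (M := M) e (S ∪ T)
  have c6 := rkInt_insert_le (M := M) f (S ∪ T)
  have c7 := rkInt_insert_le (M := M) e S
  have c8 := rkInt_insert_le (M := M) f T
  have e1 := localConn_mono_left (M := M) (Set.subset_insert e S) T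
  have e2 := localConn_mono_right (M := M) S (Set.subset_insert f T)
  have e3 := localConn_mono_left (M := M) (Set.subset_insert e S) B
  have e4 := localConn_mono_right (M := M) A (Set.subset_insert f T)
  have e5 := localConn_sub_le_sub (M := M) (Set.subset_insert e S) h.right_subset
  have e6 := localConn_sub_le_sub (M := M) h.left_subset (Set.subset_insert f T)
  have hc := hc _ hSe _ hTf
  unfold SpansGutsPoint ExactlyTwo at *
  omega

end Finite

end Guts

/-! ### Strands, and reduction of compatibility to them. -/

section Strand

variable {α : Type*} {M : Matroid α} {A B A₀ B₀ S T : Set α}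

/-- A set meeting the guts in a single point contains a strand with the same connections. -/
lemma exists_isStrand_subset [M.Finite] (hA : A.Finite) (hS : S ⊆ A) (h : M.localConn S B = 1) :
    ∃ A₁ ⊆ S, M.IsStrand A B A₁ ∧ ∀ T ⊆ B, M.localConn A₁ T = M.localConn S T := by
  obtain ⟨A₁, hle, hmin⟩ := Set.Finite.exists_le_minimal
    (s := {S' | S' ⊆ A ∧ M.localConn S' B = 1}) (hA.finite_subsets.subset fun _ h ↦ h.1) ⟨hS, h⟩
  -- The loss of connectivity to `T` is at most the loss to `B`, which is `1 - 1 = 0`.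
  refine ⟨A₁, hle, hmin, fun T hT ↦ ?_⟩
  have h1 := localConn_sub_le_sub (M := M) hle hT
  have h2 := localConn_mono_left (M := M) hle T
  have h3 : M.localConn A₁ B = 1 := hmin.prop.2
  omega

lemma IsStrand.localConn_eq_zero_of_ssubset [M.Finite] (h : M.IsStrand A B A₀) (hS : S ⊂ A₀) :
    M.localConn S B = 0 := by
  have h1 := localConn_mono_left (M := M) hS.subset B
  have h2 := localConn_nonneg (M := M) S B
  have h3 : M.localConn A₀ B = 1 := h.prop.2
  have h4 : M.localConn S B ≠ 1 := fun h' ↦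
    hS.not_subset (h.le_of_le ⟨hS.subset.trans h.prop.1, h'⟩ hS.subset)
  omega

/-- Deleting an element spanned by the rest would leave the connectivity to `B` at 1, against
minimality. -/
lemma IsStrand.indep [M.Finite] (h : M.IsStrand A B A₀) (hA : A ⊆ M.E) : M.Indep A₀ := by
  rw [indep_iff_forall_notMem_closure_sdiff (h.prop.1.trans hA)]
  intro e he hcl
  have hr : M.rkInt (insert e (A₀ \ {e})) = M.rkInt (A₀ \ {e}) := by
    rw [rkInt, rkInt, ← eRk_closure_eq, closure_insert_eq_of_mem_closure hcl, eRk_closure_eq]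
  have h1 := M.localConn_insert_left e (A₀ \ {e}) B
  rw [rkInt_insert_eq_of_subset Set.subset_union_left hr, hr, Set.insert_sdiff_singleton,
    Set.insert_eq_of_mem he, h.localConn_eq_zero_of_ssubset (Set.sdiff_singleton_ssubset.2 he)] at h1
  have h3 : M.localConn A₀ B = 1 := h.prop.2
  omega

lemma IsExactThreeSeparation.isGutsPair (hAB : M.IsExactThreeSeparation A B)
    (hA₀ : M.IsStrand A B A₀) (hB₀ : M.IsStrand B A B₀) (h₀ : M.localConn A₀ B₀ = 1) :
    M.IsGutsPair A B A₀ B₀ where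
  left_subset := hA₀.prop.1
  right_subset := hB₀.prop.1
  conn_sides := by rw [localConn, hAB.union_eq, hAB.conn_eq]
  conn_left := hA₀.prop.2
  conn_right := M.localConn_comm A B₀ ▸ hB₀.prop.2
  conn_pair := h₀

lemma IsExactThreeSeparation.left_subset_ground (hAB : M.IsExactThreeSeparation A B) : A ⊆ M.E :=
  hAB.union_eq ▸ Set.subset_union_left

lemma IsExactThreeSeparation.right_subset_ground (hAB : M.IsExactThreeSeparation A B) : B ⊆ M.E :=
  hAB.union_eq ▸ Set.subset_union_right

lemma IsExactThreeSeparation.isCompatiblePair_iff [M.Finite] (hAB : M.IsExactThreeSeparation A B)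
    (h₀ : M.IsGutsPair A B A₀ B₀) : M.IsCompatiblePair A B A₀ B₀ ↔
      ¬ ∃ A₁ B₁ : Set α, M.IsStrand A B A₁ ∧ M.IsStrand B A B₁ ∧ A₁ ≠ A₀ ∧ B₁ ≠ B₀ ∧
        ExactlyTwo (M.localConn A₀ B₁ = 1) (M.localConn A₁ B₀ = 1) (M.localConn A₁ B₁ = 1) := by
  constructor
  · rintro h ⟨A₁, B₁, hA₁, hB₁, -, -, h2⟩
    exact h A₁ hA₁.prop.1 B₁ hB₁.prop.1 hA₁.prop.2 (M.localConn_comm A B₁ ▸ hB₁.prop.2) h2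
  · intro h S hS T hT hSB hAT h2
    obtain ⟨A₁, hA₁S, hA₁, hA₁c⟩ :=
      exists_isStrand_subset (M.set_finite A hAB.left_subset_ground) hS hSB
    obtain ⟨B₁, hB₁T, hB₁, hB₁c⟩ :=
      exists_isStrand_subset (M.set_finite B hAB.right_subset_ground) hT
        (M.localConn_comm T A ▸ hAT)
    have e1 := hA₁c _ h₀.right_subset
    have e2 := hA₁c _ hT
    have e3 := hB₁c _ h₀.left_subset
    have e4 := hB₁c _ (hA₁S.trans hS)
    rw [localConn_comm, M.localConn_comm T] at e3 e4
    have e5 := h₀.conn_pair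
    refine h ⟨A₁, B₁, hA₁, hB₁, ?_, ?_, by rwa [e3, e1, e4, e2]⟩
    -- With `A₁ = A₀` one proposition holds and the other two coincide, so the count of true ones is
    -- 1 or 3. The case `B₁ = B₀` is alike.
    · rintro rfl
      unfold ExactlyTwo at h2
      omega
    · rintro rfl
      unfold ExactlyTwo at h2
      omega

end Strand

/-! ### Construction of the extension, and analysis of an arbitrary one. -/

section Extension

variable {α : Type*} {M N : Matroid α} {A B A₀ B₀ S T X Y I : Set α} {p : α}

lemma SpansGutsPoint.mono_right [M.Finite] {T' : Set α} (hG : M.SpansGutsPoint A B A₀ B₀ S T)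
    (h : M.IsGutsPair A B A₀ B₀) (hS : S ⊆ A) (hTT' : T ⊆ T') (hT' : T' ⊆ B) :
    M.SpansGutsPoint A B A₀ B₀ S T' := by
  rw [spansGutsPoint_comm] at *
  exact hG.mono_left h.symm hTT' hT' hS

lemma insert_inter_eq_of_mem_of_disjoint (hdj : Disjoint A B) {e : α} (he : e ∈ A)
    (X : Set α) :
    insert e X ∩ A = insert e (X ∩ A) ∧ insert e X ∩ B = X ∩ B :=
  ⟨Set.insert_inter_of_mem he, Set.insert_inter_of_notMem (hdj.notMem_of_mem_left he)⟩

/-- The extension by a point on the guts determined by a compatible pair of strands. -/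
theorem IsExactThreeSeparation.exists_isExtensionBy [M.Finite]
    (hAB : M.IsExactThreeSeparation A B) (h : M.IsGutsPair A B A₀ B₀)
    (hc : M.IsCompatiblePair A B A₀ B₀) (hp : p ∉ M.E) :
    ∃ N : Matroid α, N.IsExtensionBy M p ∧ ∀ I ⊆ M.E, N.Indep (insert p I) ↔
      M.Indep I ∧ ¬ M.SpansGutsPoint A B A₀ B₀ (I ∩ A) (I ∩ B) := by
  have hl {e : α} (he : e ∈ A) (X : Set α) :=
    insert_inter_eq_of_mem_of_disjoint hAB.disjoint he X
  have hr {e : α} (he : e ∈ B) (X : Set α) :=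
    insert_inter_eq_of_mem_of_disjoint hAB.disjoint.symm he X
  have hcases : ∀ e ∈ M.E, e ∈ A ∨ e ∈ B := fun e he ↦ by rwa [← hAB.union_eq] at he
  have hX' : ∀ X ⊆ M.E, X ∩ A ∪ X ∩ B = X := fun X hX ↦ by
    rw [← Set.inter_union_distrib_left, hAB.union_eq, Set.inter_eq_self_of_subset_left hX]
  refine M.exists_isExtensionBy_of_spanning_family hp
    (fun X ↦ M.SpansGutsPoint A B A₀ B₀ (X ∩ A) (X ∩ B)) ?_ ?_ ?_
  · intro X hX e he hG
    exact (hG.mono_left h (Set.inter_subset_inter_left A (Set.subset_insert e X))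
      Set.inter_subset_right Set.inter_subset_right).mono_right h Set.inter_subset_right
      (Set.inter_subset_inter_left B (Set.subset_insert e X)) Set.inter_subset_right
  · intro X hX e he hrk hG
    rw [← hX' X hX] at hrk
    obtain heA | heB := hcases e he
    · rw [(hl heA X).1, (hl heA X).2] at hG
      exact hG.of_insert_left h hc heA Set.inter_subset_right Set.inter_subset_right hrk
    · rw [(hr heB X).1, (hr heB X).2, spansGutsPoint_comm] at hG
      rw [spansGutsPoint_comm]
      rw [Set.union_comm] at hrk
      exact hG.of_insert_left h.symm hc.symm heB Set.inter_subset_right Set.inter_subset_right hrk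
  · intro X hX e he f hf hrk hGe hGf
    rw [← hX' X hX] at hrk
    obtain heA | heB := hcases e he
    · rw [(hl heA X).1, (hl heA X).2] at hGe
      obtain hfA | hfB := hcases f hf
      · rw [(hl hfA X).1, (hl hfA X).2] at hGf
        exact hGe.of_insert_insert_left hGf h heA hfA Set.inter_subset_right
          Set.inter_subset_right hrk
      · rw [(hr hfB X).1, (hr hfB X).2] at hGf
        exact hGe.of_insert_left_of_insert_right hGf h hc heA hfB Set.inter_subset_right
          Set.inter_subset_right hrk
    · rw [(hr heB X).1, (hr heB X).2] at hGe
      obtain hfA | hfB := hcases f hf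
      · rw [(hl hfA X).1, (hl hfA X).2] at hGf
        rw [Set.insert_comm] at hrk
        exact hGf.of_insert_left_of_insert_right hGe h hc hfA heB Set.inter_subset_right
          Set.inter_subset_right hrk
      · rw [(hr hfB X).1, (hr hfB X).2, spansGutsPoint_comm] at hGf
        rw [spansGutsPoint_comm] at hGe ⊢
        rw [Set.union_comm] at hrk
        exact hGe.of_insert_insert_left hGf h.symm heB hfB Set.inter_subset_right
          Set.inter_subset_right hrk

lemma IsStrand.isCircuit_insert [M.Finite] (hA₀ : M.IsStrand A B A₀) (hA : A ⊆ M.E)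
    (hdj : Disjoint A B) (hB₀ : B₀ ⊆ B) (h₀ : M.localConn A₀ B₀ = 1) (hN : N.IsExtensionBy M p)
    (hp : p ∉ M.E)
    (hind : ∀ I ⊆ M.E, N.Indep (insert p I) ↔
      M.Indep I ∧ ¬ M.SpansGutsPoint A B A₀ B₀ (I ∩ A) (I ∩ B)) :
    N.IsCircuit (insert p A₀) := by
  have hpN := hN.1
  have hA₀E : A₀ ⊆ M.E := hA₀.prop.1.trans hA
  have hpA₀ : p ∉ A₀ := fun hp' ↦ hp (hA₀E hp')
  have hME : M.E ⊆ N.E := by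
    rw [← hN.2]
    exact Set.sdiff_subset
  have hindep : ∀ I, M.Indep I → N.Indep I := fun I hI ↦ by
    rw [← hN.2, delete_indep_iff] at hI
    exact hI.1
  have hinter : ∀ I ⊆ A₀, I ∩ A = I ∧ I ∩ B = ∅ := fun I hI ↦
    ⟨Set.inter_eq_self_of_subset_left (hI.trans hA₀.prop.1),
      (hdj.mono_left (hI.trans hA₀.prop.1)).inter_eq⟩
  rw [isCircuit_iff_dep_forall_sdiff_singleton_indep]
  refine ⟨⟨?_, Set.insert_subset hpN (hA₀E.trans hME)⟩, ?_⟩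
  · rw [hind _ hA₀E, (hinter _ subset_rfl).1]
    exact fun h ↦ h.2 (Or.inl h₀)
  · intro e he
    by_cases hep : e = p
    · rw [hep, Set.insert_sdiff_self_of_notMem hpA₀]
      exact hindep _ (hA₀.indep hA)
    have heA₀ : e ∈ A₀ := he.resolve_left hep
    have hss : A₀ \ {e} ⊂ A₀ := Set.sdiff_singleton_ssubset.2 heA₀
    rw [Set.insert_sdiff_of_notMem _ (by simpa using Ne.symm hep), hind _ (hss.subset.trans hA₀E),
      (hinter _ hss.subset).1, (hinter _ hss.subset).2]
    -- Two clauses of `SpansGutsPoint` fail because the part in `B` is empty, the other because a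
    -- proper subset of a strand has connectivity 0 to `B`.
    refine ⟨(hA₀.indep hA).subset hss.subset, ?_⟩
    have h1 := hA₀.localConn_eq_zero_of_ssubset hss
    have h2 := localConn_mono_right (M := M) (A₀ \ {e}) hB₀
    rw [SpansGutsPoint, localConn_empty_right, localConn_empty_right, localConn_empty_right]
    omega

lemma IsExtensionBy.ground_eq (hN : N.IsExtensionBy M p) : N.E = insert p M.E := by
  rw [← hN.2, delete_ground, Set.insert_sdiff_singleton, Set.insert_eq_of_mem hN.1]

lemma IsExtensionBy.rkInt_eq (hN : N.IsExtensionBy M p) (hX : X ⊆ M.E) :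
    M.rkInt X = N.rkInt X := by
  have hX' : X ⊆ N.E \ {p} := by rwa [← delete_ground, hN.2]
  rw [rkInt, rkInt, ← hN.2, delete_eq_restrict, restrict_eRk_eq _ hX']

lemma IsExtensionBy.localConn_eq (hN : N.IsExtensionBy M p) (hX : X ⊆ M.E) (hY : Y ⊆ M.E) :
    M.localConn X Y = N.localConn X Y := by
  rw [localConn, localConn, hN.rkInt_eq hX, hN.rkInt_eq hY, hN.rkInt_eq (Set.union_subset hX hY)]

lemma IsExtensionBy.indep_iff (hN : N.IsExtensionBy M p) (hp : p ∉ I) :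
    N.Indep I ↔ M.Indep I := by
  rw [← hN.2, delete_indep_iff, Set.disjoint_singleton_right, and_iff_left hp]

lemma IsExtensionBy.finite [M.Finite] (hN : N.IsExtensionBy M p) : N.Finite :=
  ⟨hN.ground_eq ▸ M.ground_finite.insert p⟩

lemma IsCircuit.rkInt_insert_eq [N.Finite] (hC : N.IsCircuit (insert p X)) (hp : p ∉ X) :
    N.rkInt (insert p X) = N.rkInt X := by
  have h := hC.mem_closure_sdiff_singleton_of_mem (Set.mem_insert p X)
  rw [Set.insert_sdiff_self_of_notMem hp] at h
  rw [rkInt, rkInt, ← eRk_closure_eq, closure_insert_eq_of_mem_closure h, eRk_closure_eq]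

lemma IsCircuit.rkInt_singleton [N.Finite] (hC : N.IsCircuit (insert p X)) (hp : p ∉ X)
    (hX : X.Nonempty) : N.rkInt {p} = 1 := by
  have h : N.Indep {p} := hC.ssubset_indep <| (Set.ssubset_iff_of_subset (by simp)).2 <| by
    obtain ⟨x, hx⟩ := hX
    exact ⟨x, Set.mem_insert_of_mem p hx, fun h ↦ hp (h ▸ hx)⟩
  simpa using (indep_iff_rkInt.1 h).2

lemma indep_insert_iff_rkInt [N.Finite] (hp : p ∈ N.E) (hpI : p ∉ I) :
    N.Indep (insert p I) ↔ N.Indep I ∧ N.rkInt (insert p I) ≠ N.rkInt I := by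
  by_cases hI : N.Indep I
  · have h1 := indep_iff_rkInt.1 hI
    have h2 := rkInt_insert_le (M := N) p I
    have h3 := rkInt_le_insert (M := N) p I
    rw [indep_iff_rkInt, Set.ncard_insert_of_notMem hpI (N.set_finite I h1.1),
      and_iff_right (Set.insert_subset hp h1.1), and_iff_right hI]
    push_cast
    omega
  · exact iff_of_false (fun h ↦ hI (h.subset (Set.subset_insert p I))) (fun h ↦ hI h.1)

/-! ### What a point spanned by both `A₀` and `B₀` forces. -/

section SpannedPoint

variable [N.Finite]

/-- If `S` spans the nonloop `p`, then `S` and `B₀` share it, so their connectivity is positive.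
Conversely, if `⊓(S, B₀) = 1` and `p` raised the rank of `S`, then `⊓(S ∪ {p}, B₀) = 2`, exceeding
`⊓(A ∪ {p}, B₀) = ⊓(A, B₀) = 1`. -/
lemma IsGutsPair.rkInt_insert_eq_iff_left (h : N.IsGutsPair A B A₀ B₀)
    (hp : N.rkInt {p} = 1) (hpA : N.rkInt (insert p A₀) = N.rkInt A₀)
    (hpB : N.rkInt (insert p B₀) = N.rkInt B₀) (hS : S ⊆ A) :
    N.rkInt (insert p S) = N.rkInt S ↔ N.localConn S B₀ = 1 := by
  have h1 := h.localConn_right_le hS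
  have h2 := rkInt_insert_eq_of_subset (h.left_subset.trans Set.subset_union_left) hpA (Y := A ∪ B₀)
  have h3 := rkInt_insert_eq_of_subset h.left_subset hpA
  have h4 := rkInt_insert_eq_of_subset Set.subset_union_right hpB (Y := S ∪ B₀)
  have h5 := N.localConn_insert_left p S B₀
  have h6 := N.localConn_insert_left p A B₀
  have h7 := localConn_mono_left (M := N) (Set.insert_subset_insert (a := p) hS) B₀
  have h8 := rkInt_union_add_le (M := N) (Z := {p}) (X := insert p S) (Y := insert p B₀)
    (by simp) (by simp)
  rw [← Set.insert_union_distrib] at h8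
  have h9 := rkInt_insert_le (M := N) p S
  have b1 := rkInt_le_insert (M := N) p S
  have b2 := h.conn_right
  have b3 : N.localConn S B₀ = N.rkInt S + N.rkInt B₀ - N.rkInt (S ∪ B₀) := rfl
  omega

lemma IsGutsPair.rkInt_insert_eq_iff_right (h : N.IsGutsPair A B A₀ B₀)
    (hp : N.rkInt {p} = 1) (hpA : N.rkInt (insert p A₀) = N.rkInt A₀)
    (hpB : N.rkInt (insert p B₀) = N.rkInt B₀) (hT : T ⊆ B) :
    N.rkInt (insert p T) = N.rkInt T ↔ N.localConn A₀ T = 1 := by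
  rw [localConn_comm]
  exact h.symm.rkInt_insert_eq_iff_left hp hpB hpA hT

/-- Two sets that both span `p` have connectivity 1. If `S` spans `p` and `⊓(S, T) = 1`, then `T`
spans `p`, since otherwise `⊓(S, T ∪ {p}) = 2` while `⊓(S, B ∪ {p}) = 1`; likewise with the sides
exchanged. -/
lemma IsGutsPair.isCompatiblePair_of_spanned_point (h : N.IsGutsPair A B A₀ B₀)
    (hp : N.rkInt {p} = 1) (hpA : N.rkInt (insert p A₀) = N.rkInt A₀)
    (hpB : N.rkInt (insert p B₀) = N.rkInt B₀) : N.IsCompatiblePair A B A₀ B₀ := by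
  intro S hS T hT hSB hAT
  rw [← h.rkInt_insert_eq_iff_left hp hpA hpB hS, ← h.rkInt_insert_eq_iff_right hp hpA hpB hT]
  have h1 := h.localConn_le hS hT
  have h2 := rkInt_insert_eq_of_subset h.left_subset hpA
  have h3 := rkInt_insert_eq_of_subset h.right_subset hpB
  have h4 := N.localConn_insert_left p S T
  have h5 := N.localConn_insert_right p S T
  have h6 := N.localConn_insert_left p A T
  have h7 := N.localConn_insert_right p S B
  have h8 := localConn_mono_left (M := N) (Set.insert_subset_insert (a := p) hS) T
  have h9 := localConn_mono_right (M := N) S (Set.insert_subset_insert (a := p) hT)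
  have b1 := rkInt_union_add_le (M := N) (Z := {p}) (X := insert p S) (Y := insert p T)
    (by simp) (by simp)
  rw [← Set.insert_union_distrib] at b1
  have b2 : N.localConn S T = N.rkInt S + N.rkInt T - N.rkInt (S ∪ T) := rfl
  have b3 := rkInt_insert_eq_of_subset (M := N) (e := p) (Set.subset_union_left (s := S) (t := T))
  have b4 := rkInt_insert_eq_of_subset (M := N) (e := p) (Set.subset_union_right (s := S) (t := T))
  have b5 := rkInt_insert_le (M := N) p S
  have b6 := rkInt_insert_le (M := N) p T
  have b7 := rkInt_le_insert (M := N) p S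
  have b8 := rkInt_le_insert (M := N) p T
  have b9 := rkInt_le_insert (M := N) p (A ∪ T)
  have c1 := rkInt_le_insert (M := N) p (S ∪ B)
  have c2 := rkInt_le_insert (M := N) p (S ∪ T)
  unfold ExactlyTwo
  omega

/-- Suppose neither `S` nor `T` spans `p`. If `S ∪ T` does, then `⊓(S ∪ {p}, T ∪ {p}) = ⊓(S, T) +
2`; the bound 2 forces `⊓(S, T) = 0` and makes both sets meet the guts. Conversely, if both meet the
guts, then `S ∪ {p}` and `T ∪ {p}` each contain the whole line, so their connectivity is 2; with
`⊓(S, T) = 0` this leaves no rank increase for `p` over `S ∪ T`. -/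
lemma IsGutsPair.rkInt_insert_eq_iff_spansGutsPoint (h : N.IsGutsPair A B A₀ B₀)
    (hp : N.rkInt {p} = 1) (hpA : N.rkInt (insert p A₀) = N.rkInt A₀)
    (hpB : N.rkInt (insert p B₀) = N.rkInt B₀) (hS : S ⊆ A) (hT : T ⊆ B) :
    N.rkInt (insert p (S ∪ T)) = N.rkInt (S ∪ T) ↔ N.SpansGutsPoint A B A₀ B₀ S T := by
  rw [SpansGutsPoint, ← h.rkInt_insert_eq_iff_left hp hpA hpB hS,
    ← h.rkInt_insert_eq_iff_right hp hpA hpB hT]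
  have h2 := rkInt_insert_eq_of_subset h.left_subset hpA
  have h3 := rkInt_insert_eq_of_subset h.right_subset hpB
  have b3 := rkInt_insert_eq_of_subset (M := N) (e := p) (Set.subset_union_left (s := S) (t := T))
  have b4 := rkInt_insert_eq_of_subset (M := N) (e := p) (Set.subset_union_right (s := S) (t := T))
  have b5 := rkInt_insert_le (M := N) p S
  have b6 := rkInt_insert_le (M := N) p T
  have b7 := rkInt_le_insert (M := N) p S
  have b8 := rkInt_le_insert (M := N) p T
  have b9 := rkInt_le_insert (M := N) p (S ∪ T)
  have c0 := h.localConn_le hS hT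
  have c1 := rkInt_insert_eq_of_subset (M := N) (Set.subset_union_right (s := S)) h3
  have c2 := rkInt_insert_eq_of_subset (M := N) (Set.subset_union_left (t := T)) h2
  have c3 := rkInt_insert_eq_of_subset (M := N) (Set.subset_union_left (t := B)) h2
  have hpS := Set.insert_subset_insert (a := p) hS
  have hpT := Set.insert_subset_insert (a := p) hT
  have d1 := localConn_sub_le_sub (M := N) hpS hpT
  have d2 := localConn_mono_right (M := N) (insert p S) hpT
  have d3 := localConn_mono_left (M := N) hpS (insert p T)
  have d4 := localConn_mono_left (M := N) hpS (insert p B)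
  have d5 := localConn_mono_right (M := N) (insert p A) hpT
  have d6 := h.conn_sides
  simp only [localConn, ← Set.insert_union_distrib] at *
  omega

end SpannedPoint

/-! ### Transfer between an extension and `M`. -/

lemma IsExtensionBy.isGutsPair (hN : N.IsExtensionBy M p) (hA : A ⊆ M.E) (hB : B ⊆ M.E)
    (h : M.IsGutsPair A B A₀ B₀) : N.IsGutsPair A B A₀ B₀ where
  left_subset := h.left_subset
  right_subset := h.right_subset
  conn_sides := hN.localConn_eq hA hB ▸ h.conn_sides
  conn_left := hN.localConn_eq (h.left_subset.trans hA) hB ▸ h.conn_left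
  conn_right := hN.localConn_eq hA (h.right_subset.trans hB) ▸ h.conn_right
  conn_pair := hN.localConn_eq (h.left_subset.trans hA) (h.right_subset.trans hB) ▸ h.conn_pair

lemma IsExtensionBy.rkInt_eqs_of_isCircuit [M.Finite] (hN : N.IsExtensionBy M p)
    (hp : p ∉ M.E) (hA : A ⊆ M.E) (hB : B ⊆ M.E) (h : M.IsGutsPair A B A₀ B₀)
    (hCA : N.IsCircuit (insert p A₀)) (hCB : N.IsCircuit (insert p B₀)) :
    N.rkInt {p} = 1 ∧ N.rkInt (insert p A₀) = N.rkInt A₀ ∧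
      N.rkInt (insert p B₀) = N.rkInt B₀ := by
  have := hN.finite
  have hpA : p ∉ A₀ := fun h' ↦ hp (hA (h.left_subset h'))
  have hpB : p ∉ B₀ := fun h' ↦ hp (hB (h.right_subset h'))
  refine ⟨hCA.rkInt_singleton hpA ?_, hCA.rkInt_insert_eq hpA, hCB.rkInt_insert_eq hpB⟩
  -- A nonempty `A₀` ensures that the circuit is not `{p}`, so `p` is not a loop.
  rw [Set.nonempty_iff_ne_empty]
  rintro rfl
  simpa [localConn_empty_left] using h.conn_left

lemma IsExtensionBy.isCompatiblePair [M.Finite] (hN : N.IsExtensionBy M p)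
    (hp : p ∉ M.E) (hA : A ⊆ M.E) (hB : B ⊆ M.E) (h : M.IsGutsPair A B A₀ B₀)
    (hCA : N.IsCircuit (insert p A₀)) (hCB : N.IsCircuit (insert p B₀)) :
    M.IsCompatiblePair A B A₀ B₀ := by
  have := hN.finite
  obtain ⟨h1, h2, h3⟩ := hN.rkInt_eqs_of_isCircuit hp hA hB h hCA hCB
  intro S hS T hT
  rw [hN.localConn_eq (hS.trans hA) hB, hN.localConn_eq hA (hT.trans hB),
    hN.localConn_eq (h.left_subset.trans hA) (hT.trans hB),
    hN.localConn_eq (hS.trans hA) (h.right_subset.trans hB),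
    hN.localConn_eq (hS.trans hA) (hT.trans hB)]
  exact (hN.isGutsPair hA hB h).isCompatiblePair_of_spanned_point h1 h2 h3 S hS T hT

lemma IsExtensionBy.indep_insert_iff_of_isCircuit [M.Finite] (hN : N.IsExtensionBy M p)
    (hp : p ∉ M.E) (hAB : A ∪ B = M.E) (h : M.IsGutsPair A B A₀ B₀)
    (hCA : N.IsCircuit (insert p A₀)) (hCB : N.IsCircuit (insert p B₀)) (hI : I ⊆ M.E) :
    N.Indep (insert p I) ↔ M.Indep I ∧ ¬ M.SpansGutsPoint A B A₀ B₀ (I ∩ A) (I ∩ B) := by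
  have := hN.finite
  have hA : A ⊆ M.E := hAB ▸ Set.subset_union_left
  have hB : B ⊆ M.E := hAB ▸ Set.subset_union_right
  obtain ⟨h1, h2, h3⟩ := hN.rkInt_eqs_of_isCircuit hp hA hB h hCA hCB
  have h4 := (hN.isGutsPair hA hB h).rkInt_insert_eq_iff_spansGutsPoint h1 h2 h3
    (Set.inter_subset_right (s := I)) (Set.inter_subset_right (s := I))
  have hIA : I ∩ A ⊆ M.E := Set.inter_subset_left.trans hI
  have hIB : I ∩ B ⊆ M.E := Set.inter_subset_left.trans hI
  rw [← Set.inter_union_distrib_left, hAB, Set.inter_eq_self_of_subset_left hI, SpansGutsPoint,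
    ← hN.localConn_eq hIA hB, ← hN.localConn_eq hA hIB,
    ← hN.localConn_eq (h.left_subset.trans hA) hIB,
    ← hN.localConn_eq hIA (h.right_subset.trans hB),
    ← hN.localConn_eq hIA hIB, ← SpansGutsPoint] at h4
  have hpI : p ∉ I := fun h' ↦ hp (hI h')
  rw [indep_insert_iff_rkInt hN.1 hpI, ne_eq, h4, hN.indep_iff hpI]

lemma IsExtensionBy.eq_of_indep_insert_iff {N' : Matroid α} (hN : N.IsExtensionBy M p)
    (hN' : N'.IsExtensionBy M p)
    (h : ∀ I ⊆ M.E, N.Indep (insert p I) ↔ N'.Indep (insert p I)) : N = N' := by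
  refine ext_indep (hN.ground_eq.trans hN'.ground_eq.symm) fun I hI ↦ ?_
  by_cases hpI : p ∈ I
  · have := h (I \ {p}) (Set.sdiff_singleton_subset_iff.2 (hN.ground_eq ▸ hI))
    rwa [Set.insert_sdiff_singleton, Set.insert_eq_of_mem hpI] at this
  · rw [hN.indep_iff hpI, hN'.indep_iff hpI]

end Extension

end Matroid


theorem theorem1p1 {α : Type*} (M : Matroid α) [M.Finite] (A B A₀ B₀ : Set α)
    (hAB : M.IsExactThreeSeparation A B)
    (hA₀ : M.IsStrand A B A₀) (hB₀ : M.IsStrand B A B₀)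
    (h₀ : M.localConn A₀ B₀ = 1)
    (p : α) (hp : p ∉ M.E) :
    ((∃ N : Matroid α, N.IsExtensionBy M p ∧
        N.IsCircuit (insert p A₀) ∧ N.IsCircuit (insert p B₀)) ↔
      ¬ ∃ A₁ B₁ : Set α, M.IsStrand A B A₁ ∧ M.IsStrand B A B₁ ∧ A₁ ≠ A₀ ∧ B₁ ≠ B₀ ∧
        ExactlyTwo (M.localConn A₀ B₁ = 1) (M.localConn A₁ B₀ = 1) (M.localConn A₁ B₁ = 1)) ∧
    (∀ N N' : Matroid α,
      (N.IsExtensionBy M p ∧ N.IsCircuit (insert p A₀) ∧ N.IsCircuit (insert p B₀)) →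
      (N'.IsExtensionBy M p ∧ N'.IsCircuit (insert p A₀) ∧ N'.IsCircuit (insert p B₀)) →
      N = N') := by
  have h := hAB.isGutsPair hA₀ hB₀ h₀
  have hA := hAB.left_subset_ground
  have hB := hAB.right_subset_ground
  refine ⟨?_, ?_⟩
  · rw [← hAB.isCompatiblePair_iff h]
    refine ⟨fun ⟨N, hN, hCA, hCB⟩ ↦ hN.isCompatiblePair hp hA hB h hCA hCB, fun hc ↦ ?_⟩
    obtain ⟨N, hN, hind⟩ := hAB.exists_isExtensionBy h hc hp
    refine ⟨N, hN, hA₀.isCircuit_insert hA hAB.disjoint h.right_subset h₀ hN hp hind,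
      hB₀.isCircuit_insert hB hAB.disjoint.symm h.left_subset
        (M.localConn_comm A₀ B₀ ▸ h₀) hN hp fun I hI ↦ ?_⟩
    -- The spanning condition is symmetric in the two sides, so the circuit through `B₀` comes from
    -- the same lemma.
    rw [hind I hI, Matroid.spansGutsPoint_comm]
  · rintro N N' ⟨hN, hCA, hCB⟩ ⟨hN', hCA', hCB'⟩
    refine hN.eq_of_indep_insert_iff hN' fun I hI ↦ ?_
    rw [hN.indep_insert_iff_of_isCircuit hp hAB.union_eq h hCA hCB hI,
      hN'.indep_insert_iff_of_isCircuit hp hAB.union_eq h hCA' hCB' hI]
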